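/- Let $a>0$ and let $L_1=i\frac{d}{dx}$ on $L^2(-a,a)$ be the minimal operator: its domain consists of those $f\in L^2(-a,a)$ that have a locally absolutely continuous representative with $f'\in L^2(-a,a)$ and $\lim_{x\to\pm a}f(x)=0$. For $w\in\mathbb C$ put $\phi(w;x)=e^{-iwx}$ and $\tilde\phi(\pm i;\cdot)=\phi(\pm i;\cdot)/\|\phi(\pm i;\cdot)\|_{L^2(-a,a)}$. Then $L_1$ is densely defined and, for every nonreal $w$, the function $\phi(w;\cdot)$ spans $\ker(L_1^*-w)$. The Liv\v sic characteristic function of $L_1$ is $$B(w)=\frac{w-i}{w+i}\,A(w,i)^{-1}A(w,-i),\qquad A(w,\pm i)=\langle \phi(w;\cdot),\tilde\phi(\pm i;\cdot)\rangle_{L^2(-a,a)},\qquad w\in\mathbb C_+ ,$$ where the inner product is linear in its first entry. For $\alpha\in\mathbb T$, with complex conjugate $\alpha^*$, let $L_{1,\alpha}$ be the restriction of $L_1^*$ to $\operatorname{dom}L_1+\operatorname{span}\{\alpha\tilde\phi(-i;\cdot)-\tilde\phi(i;\cdot)\}$. The Clark measure of $L_{1,\alpha}$ is the positive Borel measure $\mu$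 on $\mathbb R$ with $\int\frac{d\mu(t)}{1+t^2}<\infty$ for which there is a constant $c\ge 0$ such that, for all $w\in\mathbb C_+$, $$\operatorname{Re}\frac{1+B(w)\alpha^*}{1-B(w)\alpha^*}=c\,\operatorname{Im}w+\int_{\mathbb R}\operatorname{Re}\Bigl(\frac1{i\pi}\,\frac1{t-w}\Bigr)\,d\mu(t).$$ Theorem. For all $w\in\mathbb C_+$ one has $\sin((w+i)a)\neq 0$ and $$B(w)=\frac{\sin((w-i)a)}{\sin((w+i)a)} .$$ For every $\alpha\in\mathbb T$ the Clark measure $\mu$ of $L_{1,\alpha}$ exists and is unique, and the set of its point masses, $\{s\in\mathbb R:\mu(\{s\})\neq0\}$, is exactly $$P_\alpha=\Bigl\{s=\frac1a\tan^{-1}\Bigl(\frac{\alpha^*+1}{\alpha^*-1}\tan(ia)\Bigr)+\frac{n\pi}{a}\;:\;n\in\mathbb Z\Bigr\},$$ where $\tan^{-1}$ is the principal branch, whose argument is real for $\alpha\ne1$, and where for $\alpha=1$ the value of $\tan^{-1}$ is read as $\tan^{-1}(\pm\infty)=\pm\pi/2$ (either sign gives the same set $P_1$). -/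

import Mathlib

open MeasureTheory Set Filter Topology

noncomputable section

namespace ClarkInterval

/-! ### Symmetric operators with deficiency indices `(1, 1)` and their extensions -/

section General

variable {H : Type*} [NormedAddCommGroup H] [InnerProductSpace ℂ H] [CompleteSpace H]

/-- The defect space `ker (T* - w)`, that is, all `f` in the domain of `T*` with `T* f = w f`. -/
def defectSpace (T : H →ₗ.[ℂ] H) (w : ℂ) : Submodule ℂ H :=
  T.adjoint.graph.comap (LinearMap.prod LinearMap.id (w • LinearMap.id))

/-- `T` is densely defined and, for each nonreal `w`, the vector `ψ w` is a basis of the defect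
space `ker (T* - w)`; in particular the deficiency indices of `T` are `(1, 1)`. -/
def IsDefectBasis (T : H →ₗ.[ℂ] H) (ψ : ℂ → H) : Prop :=
  Dense (T.domain : Set H) ∧
    ∀ w : ℂ, w.im ≠ 0 → ψ w ≠ 0 ∧ defectSpace T w = Submodule.span ℂ {ψ w}

/-- The normalized (orthonormal) basis vector of the defect space. -/
def unitDefect (ψ : ℂ → H) (z : ℂ) : H := (‖ψ z‖⁻¹ : ℂ) • ψ z

/-- The analytic Gram matrix (a scalar here) `A(w, z) = ⟨ψ(w), ψ̃(z)⟩`, with the inner product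
linear in the first entry; Mathlib's `inner` is linear in the second one. -/
def gram (ψ : ℂ → H) (w z : ℂ) : ℂ := inner ℂ (unitDefect ψ z) (ψ w)

/-- The characteristic function `B(w) = (w - i) / (w + i) * A(w, i)⁻¹ * A(w, -i)`. -/
def livsic (ψ : ℂ → H) (w : ℂ) : ℂ :=
  (w - Complex.I) / (w + Complex.I) * (gram ψ w Complex.I)⁻¹ * gram ψ w (-Complex.I)

/-- The extension `T_α` of `T`: the restriction of `T*` to `dom T + span {α φ⁻ - φ⁺}`, where
`φ⁺` and `φ⁻` are the normalized basis vectors of `ker (T* - i)` and `ker (T* + i)`. -/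
def extension (T : H →ₗ.[ℂ] H) (ψ : ℂ → H) (α : ℂ) : H →ₗ.[ℂ] H :=
  T.adjoint.domRestrict
    (T.domain ⊔
      Submodule.span ℂ {α • unitDefect ψ (-Complex.I) - unitDefect ψ Complex.I})

end General

/-! ### Clark measures on the real line -/

/-- `μ` is the Clark measure `μ^{B α*}` of `B` on the upper half-plane: it represents the positive
harmonic function `Re ((1 - B α*)⁻¹ (1 + B α*))` through Nevanlinna's formula. -/
def IsClarkMeasure (B : ℂ → ℂ) (α : ℂ) (μ : Measure ℝ) : Prop :=
  Integrable (fun t : ℝ => 1 / (1 + t ^ 2)) μ ∧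
    ∃ c : ℝ, 0 ≤ c ∧ ∀ w : ℂ, 0 < w.im →
      ((1 - B w * star α)⁻¹ * (1 + B w * star α)).re =
        c * w.im + ∫ t : ℝ, (1 / (Complex.I * Real.pi) * (1 / ((t : ℂ) - w))).re ∂μ

/-- `μ` is the Clark measure of the extension `S` of `T` (relative to the defect vectors `ψ`):
`S = T_α` for a unimodular `α`, and `μ = μ^{B α*}` for the characteristic function `B` of `T`. -/
def IsClarkMeasureOf {H : Type*} [NormedAddCommGroup H] [InnerProductSpace ℂ H] [CompleteSpace H]
    (T : H →ₗ.[ℂ] H) (ψ : ℂ → H) (S : H →ₗ.[ℂ] H) (μ : Measure ℝ) : Prop :=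
  IsDefectBasis T ψ ∧
    ∃ α : ℂ, ‖α‖ = 1 ∧ S = extension T ψ α ∧ IsClarkMeasure (livsic ψ) α μ

/-! ### The operator `i d/dx` on `L²(-a, a)` -/

/-- The Hilbert space `L²(-a, a)`. -/
abbrev L2 (a : ℝ) : Type := Lp ℂ 2 (volume.restrict (Ioo (-a) a))

/-- Local absolute continuity on the open interval `(-a, a)`. -/
def ACLoc (a : ℝ) (F : ℝ → ℂ) : Prop :=
  ∀ c ∈ Ioo (-a) a, ∀ d ∈ Ioo (-a) a, AbsolutelyContinuousOnInterval F c d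

/-- The graph of the maximal operator: pairs `(f, g)` in `L²(-a, a)` such that `f` has a locally
absolutely continuous representative `F` with `i F' = g`, that is `F' = -i g`, a.e. -/
def maxGraph (a : ℝ) : Submodule ℂ (L2 a × L2 a) where
  carrier := {p | ∃ F : ℝ → ℂ, ACLoc a F ∧ p.1 =ᵐ[volume.restrict (Ioo (-a) a)] F ∧
    ∀ᵐ x ∂(volume.restrict (Ioo (-a) a)), HasDerivAt F (-Complex.I * p.2 x) x}
  zero_mem' := by
    refine ⟨fun _ => 0, ?_, ?_, ?_⟩
    · intro c _ d _
      simp [AbsolutelyContinuousOnInterval, tendsto_const_nhds]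
    · exact Lp.coeFn_zero _ _ _
    · filter_upwards [Lp.coeFn_zero ℂ 2 (volume.restrict (Ioo (-a) a))] with x hx
      have h : ((0 : L2 a × L2 a).2 : ℝ → ℂ) x = 0 := hx
      rw [h, mul_zero]
      exact hasDerivAt_const x 0
  add_mem' := by
    rintro ⟨f, g⟩ ⟨f', g'⟩ ⟨F, hF, hf, hg⟩ ⟨F', hF', hf', hg'⟩
    refine ⟨F + F', fun c hc d hd => (hF c hc d hd).add (hF' c hc d hd), ?_, ?_⟩
    · exact (Lp.coeFn_add f f').trans (hf.add hf')
    · filter_upwards [hg, hg', Lp.coeFn_add g g'] with x h h' hx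
      have e : (((f, g) + (f', g') : L2 a × L2 a).2 : ℝ → ℂ) x = g x + g' x := hx
      rw [e, mul_add]
      exact h.add h'
  smul_mem' := by
    rintro k ⟨f, g⟩ ⟨F, hF, hf, hg⟩
    refine ⟨fun x => k • F x, fun c hc d hd => (hF c hc d hd).const_smul k, ?_, ?_⟩
    · filter_upwards [Lp.coeFn_smul k f, hf] with x hx h
      have e : ((k • (f, g) : L2 a × L2 a).1 : ℝ → ℂ) x = k • f x := hx
      rw [e]
      exact congrArg (k • ·) h
    · filter_upwards [hg, Lp.coeFn_smul k g] with x h hx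
      have e : ((k • (f, g) : L2 a × L2 a).2 : ℝ → ℂ) x = k • g x := hx
      rw [e]
      have h2 := h.const_smul k
      convert! h2 using 1
      simp only [smul_eq_mul]
      ring

/-- `maxGraph a` is the graph of an operator, so that `maxOp` below is not a default value. -/
theorem maxGraph_singleValued (a : ℝ) (p : L2 a × L2 a) (hp : p ∈ maxGraph a) (h0 : p.1 = 0) :
    p.2 = 0 := by
  obtain ⟨F, hF, hf, hg⟩ := hp
  have hc : ContinuousOn F (Ioo (-a) a) := by
    intro x hx
    obtain ⟨c, hc1, hc2⟩ := exists_between hx.1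
    obtain ⟨d, hd1, hd2⟩ := exists_between hx.2
    have h := (hF c ⟨hc1, hc2.trans hx.2⟩ d ⟨hx.1.trans hd1, hd2⟩).continuousOn
    rw [uIcc_of_le (hc2.trans hd1).le] at h
    exact (h.continuousAt (Icc_mem_nhds hc2 hd1)).continuousWithinAt
  have hF0 : F =ᵐ[volume.restrict (Ioo (-a) a)] fun _ => (0 : ℂ) := by
    rw [h0] at hf
    exact hf.symm.trans (Lp.coeFn_zero _ _ _)
  have hEq : EqOn F (fun _ => 0) (Ioo (-a) a) :=
    Measure.eqOn_open_of_ae_eq hF0 isOpen_Ioo hc continuousOn_const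
  apply (Lp.eq_zero_iff_ae_eq_zero).2
  filter_upwards [hg, ae_restrict_mem measurableSet_Ioo] with x h hx
  have h1 : HasDerivAt F 0 x :=
    (hasDerivAt_const x (0 : ℂ)).congr_of_eventuallyEq
      (hEq.eventuallyEq_of_mem (isOpen_Ioo.mem_nhds hx))
  have h2 := h.unique h1
  simpa using h2

/-- The maximal operator `i d/dx` on `L²(-a, a)`. -/
def maxOp (a : ℝ) : L2 a →ₗ.[ℂ] L2 a := (maxGraph a).toLinearPMap

/-- Elements of `L²(-a, a)` whose continuous representative tends to `0` at both endpoints. -/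
def vanishing (a : ℝ) : Submodule ℂ (L2 a) where
  carrier := {f | ∃ F : ℝ → ℂ, ContinuousOn F (Ioo (-a) a) ∧
    f =ᵐ[volume.restrict (Ioo (-a) a)] F ∧
    Tendsto F (𝓝[>] (-a)) (𝓝 0) ∧ Tendsto F (𝓝[<] a) (𝓝 0)}
  zero_mem' := ⟨fun _ => 0, continuousOn_const, Lp.coeFn_zero _ _ _, tendsto_const_nhds,
    tendsto_const_nhds⟩
  add_mem' := by
    rintro f g ⟨F, hF, hf, h1, h2⟩ ⟨G, hG, hg, k1, k2⟩
    refine ⟨F + G, hF.add hG, (Lp.coeFn_add f g).trans (hf.add hg), ?_, ?_⟩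
    · have h := h1.add k1
      rw [add_zero] at h
      exact h
    · have h := h2.add k2
      rw [add_zero] at h
      exact h
  smul_mem' := by
    rintro k f ⟨F, hF, hf, h1, h2⟩
    refine ⟨fun x => k • F x, hF.const_smul k, ?_, ?_, ?_⟩
    · filter_upwards [Lp.coeFn_smul k f, hf] with x hx h
      rw [hx, Pi.smul_apply, h]
    · simpa using h1.const_smul k
    · simpa using h2.const_smul k

/-- The minimal operator `L₁ = i d/dx` on `L²(-a, a)`: the restriction of the maximal operator to
the functions that vanish at both endpoints. -/
def minOp (a : ℝ) : L2 a →ₗ.[ℂ] L2 a := (maxOp a).domRestrict (vanishing a)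

theorem memLp_exp (a : ℝ) (w : ℂ) :
    MemLp (fun x : ℝ => Complex.exp (-Complex.I * w * x)) 2 (volume.restrict (Ioo (-a) a)) := by
  have hc : Continuous (fun x : ℝ => Complex.exp (-Complex.I * w * x)) := by fun_prop
  obtain ⟨C, hC⟩ := (isCompact_Icc (a := -a) (b := a)).exists_bound_of_continuousOn hc.continuousOn
  refine MemLp.of_bound hc.aestronglyMeasurable C ?_
  filter_upwards [ae_restrict_mem measurableSet_Ioo] with x hx
  exact hC x (Ioo_subset_Icc_self hx)

/-- The solution `x ↦ e^{-iwx}` of `i f' = w f`, as an element of `L²(-a, a)`. -/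
def expVec (a : ℝ) (w : ℂ) : L2 a := (memLp_exp a w).toLp _

end ClarkInterval

end

/-!
`B(w) = sin ((w - i)a) / sin ((w + i)a)` is unimodular on `ℝ` and takes every unimodular value
there. If `α = B(s)` with `s` real, then `(1 + B α*) / (1 - B α*)` is a Möbius transform of
`tan (a(w - s))`, namely `i (p cot (a(w - s)) + q)` with `p = (cosh 2a - cos 2as) / sinh 2a` and
`q` real. By the partial fraction expansion of the cotangent its real part is the Poisson integral
of the Dirac comb with masses `p π / a` on `s + (π/a)ℤ`. This comb is the only Clark measure: the
point masses of any other one can be recovered from its Poisson integral near the real axis, so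
they agree with those of the comb, and the rest of the measure and the constant `c`, which have
nonnegative Poisson integrals, must vanish.

On the operator side, `L₁ - w` maps onto the functions `e^{-iwx} φ(x)` with `φ` of mean zero, so
`ker (L₁* - w*)` is found by the du Bois-Reymond lemma. Since `dom L₁`, `ker (L₁* - i)` and
`ker (L₁* + i)` are linearly independent, `L_{1,α}` determines `α`.
-/

noncomputable section

namespace ClarkInterval

open scoped ComplexConjugate Real ENNReal
open Complex (I)

/-! ### Poisson integrals on the upper half-plane -/

/-- The Poisson kernel of the upper half-plane, `Im w / (π |t - w|²)`, written as the imaginary part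
of a Cauchy kernel so that it can be summed by partial fractions. -/
def upperPoissonKernel (w : ℂ) (t : ℝ) : ℝ := ((t - w)⁻¹).im / π

theorem re_cauchyKernel_eq_upperPoissonKernel (w : ℂ) (t : ℝ) :
    (1 / (I * π) * (1 / ((t : ℂ) - w))).re = upperPoissonKernel w t := by
  have h : 1 / (I * π) * (1 / ((t : ℂ) - w)) = ((π⁻¹ : ℝ) : ℂ) * -(I * ((t : ℂ) - w)⁻¹) := by
    rw [one_div, one_div, mul_inv, Complex.inv_I, Complex.ofReal_inv]
    ring
  rw [h, Complex.re_ofReal_mul, Complex.neg_re, Complex.I_mul_re, neg_neg, upperPoissonKernel,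
    div_eq_inv_mul]

theorem upperPoissonKernel_eq_div (w : ℂ) (t : ℝ) :
    upperPoissonKernel w t = w.im / (π * ((t - w.re) ^ 2 + w.im ^ 2)) := by
  have h : Complex.normSq (t - w) = (t - w.re) ^ 2 + w.im ^ 2 := by
    rw [Complex.normSq_apply, Complex.sub_re, Complex.sub_im, Complex.ofReal_re, Complex.ofReal_im]
    ring
  rw [upperPoissonKernel, Complex.inv_im, h, Complex.sub_im, Complex.ofReal_im, zero_sub, neg_neg,
    div_div, mul_comm]

theorem upperPoissonKernel_pos {w : ℂ} (hw : 0 < w.im) (t : ℝ) : 0 < upperPoissonKernel w t := by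
  rw [upperPoissonKernel_eq_div]
  positivity

theorem im_mul_upperPoissonKernel_le {w : ℂ} (hw : w.im ≠ 0) (t : ℝ) :
    w.im * upperPoissonKernel w t ≤
      (1 + 2 * w.re ^ 2 + 2 * w.im ^ 2) / π * (1 / (1 + t ^ 2)) := by
  have key : w.im ^ 2 * (1 + t ^ 2) ≤
      (1 + 2 * w.re ^ 2 + 2 * w.im ^ 2) * ((t - w.re) ^ 2 + w.im ^ 2) := by
    nlinarith [mul_nonneg (sq_nonneg w.im) (sq_nonneg (t - 2 * w.re)), sq_nonneg (t - w.re),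
      mul_nonneg (sq_nonneg w.re) (sq_nonneg (t - w.re)), sq_nonneg (w.im ^ 2)]
  rw [upperPoissonKernel_eq_div, ← mul_div_assoc, ← sq, div_mul_div_comm, mul_one,
    div_le_div_iff₀ (by positivity) (by positivity)]
  calc w.im ^ 2 * (π * (1 + t ^ 2)) = π * (w.im ^ 2 * (1 + t ^ 2)) := by ring
    _ ≤ π * ((1 + 2 * w.re ^ 2 + 2 * w.im ^ 2) * ((t - w.re) ^ 2 + w.im ^ 2)) := by gcongr
    _ = (1 + 2 * w.re ^ 2 + 2 * w.im ^ 2) * (π * ((t - w.re) ^ 2 + w.im ^ 2)) := by ring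

@[fun_prop]
theorem measurable_upperPoissonKernel (w : ℂ) : Measurable (upperPoissonKernel w) := by
  unfold upperPoissonKernel
  fun_prop

theorem upperPoissonKernel_comp_affine {r : ℝ} (hr : r ≠ 0) (x₀ : ℝ) (w : ℂ) (t : ℝ) :
    upperPoissonKernel w (x₀ + t * r) = r⁻¹ * upperPoissonKernel ((w - x₀) / r) t := by
  have hr' : (r : ℂ) ≠ 0 := Complex.ofReal_ne_zero.2 hr
  have h : ((x₀ + t * r : ℝ) : ℂ) - w = (r : ℂ) * (t - (w - x₀) / r) := by
    push_cast
    field_simp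
    ring
  rw [upperPoissonKernel, h, mul_inv, ← Complex.ofReal_inv, Complex.im_ofReal_mul,
    upperPoissonKernel, mul_div_assoc]

theorem tendsto_mul_upperPoissonKernel (s t : ℝ) :
    Tendsto (fun y : ℝ => y * upperPoissonKernel ⟨s, y⟩ t) (𝓝[>] 0)
      (𝓝 (({s} : Set ℝ).indicator (fun _ => π⁻¹) t)) := by
  simp_rw [upperPoissonKernel_eq_div]
  by_cases hts : t = s
  · rw [hts, indicator_of_mem (mem_singleton s)]
    refine tendsto_const_nhds.congr' ?_
    filter_upwards [self_mem_nhdsWithin] with y hy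
    have : y ≠ 0 := ne_of_gt hy
    field_simp
    simp
  · have hne : π * ((t - s) ^ 2 + 0 ^ 2) ≠ 0 := by
      have : t - s ≠ 0 := sub_ne_zero.2 hts
      positivity
    have hc : ContinuousAt (fun y : ℝ => y * (y / (π * ((t - s) ^ 2 + y ^ 2)))) 0 := by
      fun_prop (disch := exact hne)
    rw [indicator_of_notMem (notMem_singleton_iff.2 hts)]
    simpa only [zero_mul] using hc.tendsto.mono_left nhdsWithin_le_nhds

theorem restrict_eq_restrict_of_measure_singleton_eq {X : Type*} [MeasurableSpace X]
    [MeasurableSingletonClass X] {μ ν : Measure X} {S : Set X} (hS : S.Countable)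
    (h : ∀ x ∈ S, μ {x} = ν {x}) : μ.restrict S = ν.restrict S := by
  rw [← biUnion_of_singleton S]
  refine (Measure.restrict_biUnion_congr hS).2 fun x hx => ?_
  rw [Measure.restrict_singleton, Measure.restrict_singleton, h x hx]

section PointMasses

variable {μ ν : Measure ℝ}

theorem integrable_upperPoissonKernel (hμ : Integrable (fun t : ℝ => 1 / (1 + t ^ 2)) μ) {w : ℂ}
    (hw : 0 < w.im) : Integrable (upperPoissonKernel w) μ := by
  refine (hμ.const_mul ((1 + 2 * w.re ^ 2 + 2 * w.im ^ 2) / π / w.im)).mono'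
    (measurable_upperPoissonKernel w).aestronglyMeasurable (Eventually.of_forall fun t => ?_)
  rw [Real.norm_of_nonneg (upperPoissonKernel_pos hw t).le, div_mul_eq_mul_div, le_div_iff₀ hw,
    mul_comm]
  exact im_mul_upperPoissonKernel_le hw.ne' t

theorem tendsto_mul_integral_upperPoissonKernel
    (hμ : Integrable (fun t : ℝ => 1 / (1 + t ^ 2)) μ) (s : ℝ) :
    Tendsto (fun y : ℝ => y * ∫ t, upperPoissonKernel ⟨s, y⟩ t ∂μ) (𝓝[>] 0)
      (𝓝 (μ.real {s} * π⁻¹)) := by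
  have hlim : ∫ t, ({s} : Set ℝ).indicator (fun _ => π⁻¹) t ∂μ = μ.real {s} * π⁻¹ := by
    rw [integral_indicator_const _ (measurableSet_singleton s), smul_eq_mul]
  rw [← hlim]
  simp_rw [← integral_const_mul]
  refine tendsto_integral_filter_of_dominated_convergence
    (fun t => (1 + 2 * s ^ 2 + 2 * 1 ^ 2) / π * (1 / (1 + t ^ 2))) ?_ ?_ (hμ.const_mul _)
    (Eventually.of_forall (tendsto_mul_upperPoissonKernel s))
  · exact Eventually.of_forall fun y => by fun_prop
  · filter_upwards [Ioc_mem_nhdsGT one_pos] with y hy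
    refine Eventually.of_forall fun t => ?_
    rw [Real.norm_of_nonneg (mul_nonneg hy.1.le (upperPoissonKernel_pos hy.1 t).le)]
    refine (im_mul_upperPoissonKernel_le (w := ⟨s, y⟩) hy.1.ne' t).trans ?_
    gcongr
    exacts [hy.1.le, hy.2]

theorem measure_singleton_ne_top_of_integrable
    (hμ : Integrable (fun t : ℝ => 1 / (1 + t ^ 2)) μ) (s : ℝ) : μ {s} ≠ ⊤ := by
  have h := hμ.measure_norm_ge_lt_top (ε := 1 / (1 + s ^ 2)) (by positivity)
  refine ((measure_mono ?_).trans_lt h).ne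
  exact singleton_subset_iff.2 (Real.le_norm_self _)

theorem measure_singleton_eq_of_nevanlinna_eq {b c : ℝ}
    (hμ : Integrable (fun t : ℝ => 1 / (1 + t ^ 2)) μ)
    (hν : Integrable (fun t : ℝ => 1 / (1 + t ^ 2)) ν)
    (h : ∀ w : ℂ, 0 < w.im → b * w.im + ∫ t, upperPoissonKernel w t ∂μ =
      c * w.im + ∫ t, upperPoissonKernel w t ∂ν) (s : ℝ) : μ {s} = ν {s} := by
  have hlinear (k : ℝ) : Tendsto (fun y : ℝ => y * (k * y)) (𝓝[>] 0) (𝓝 0) := by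
    have hc : Continuous fun y : ℝ => y * (k * y) := by fun_prop
    simpa only [zero_mul] using (hc.tendsto 0).mono_left nhdsWithin_le_nhds
  have hμlim := (hlinear b).add (tendsto_mul_integral_upperPoissonKernel hμ s)
  have hνlim := (hlinear c).add (tendsto_mul_integral_upperPoissonKernel hν s)
  have heq : ∀ᶠ y : ℝ in 𝓝[>] 0,
      y * (b * y) + y * ∫ t, upperPoissonKernel ⟨s, y⟩ t ∂μ =
        y * (c * y) + y * ∫ t, upperPoissonKernel ⟨s, y⟩ t ∂ν := by
    filter_upwards [self_mem_nhdsWithin] with y hy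
    rw [← mul_add, ← mul_add]
    exact congrArg (y * ·) (h ⟨s, y⟩ hy)
  have hreal := tendsto_nhds_unique (hμlim.congr' heq) hνlim
  rw [zero_add, zero_add, mul_left_inj' (inv_ne_zero Real.pi_ne_zero)] at hreal
  exact (measureReal_eq_measureReal_iff (measure_singleton_ne_top_of_integrable hμ s)
    (measure_singleton_ne_top_of_integrable hν s)).1 hreal

/-- The two measures have the same atoms, and any further mass of `μ` would add a positive Poisson
integral to that of `ν`. -/
theorem eq_of_nevanlinna_eq_of_countable {b c : ℝ} {S : Set ℝ}
    (hμ : Integrable (fun t : ℝ => 1 / (1 + t ^ 2)) μ)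
    (hν : Integrable (fun t : ℝ => 1 / (1 + t ^ 2)) ν) (hcb : c ≤ b) (hS : S.Countable)
    (hνS : ν Sᶜ = 0)
    (h : ∀ w : ℂ, 0 < w.im → b * w.im + ∫ t, upperPoissonKernel w t ∂μ =
      c * w.im + ∫ t, upperPoissonKernel w t ∂ν) : μ = ν := by
  have hrestrict : μ.restrict S = ν := by
    rw [restrict_eq_restrict_of_measure_singleton_eq hS fun s _ =>
      measure_singleton_eq_of_nevanlinna_eq hμ hν h s]
    exact Measure.restrict_eq_self_of_ae_mem (mem_ae_iff.2 hνS)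
  have hI : 0 < I.im := by rw [Complex.I_im]; exact one_pos
  have hpos (t : ℝ) : 0 < upperPoissonKernel I t := upperPoissonKernel_pos hI t
  have hint : Integrable (upperPoissonKernel I) μ := integrable_upperPoissonKernel hμ hI
  have hzero : ∫ t in Sᶜ, upperPoissonKernel I t ∂μ = 0 := by
    have hnev := h I hI
    rw [← integral_add_compl hS.measurableSet hint, hrestrict, Complex.I_im, mul_one,
      mul_one] at hnev
    exact le_antisymm (by linarith) (integral_nonneg fun t => (hpos t).le)
  have hμS : μ Sᶜ = 0 := by
    rw [setIntegral_eq_zero_iff_of_nonneg_ae (Eventually.of_forall fun t => (hpos t).le)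
      hint.integrableOn] at hzero
    rw [← Measure.restrict_eq_zero, ← ae_eq_bot, ← eventually_false_iff_eq_bot]
    exact hzero.mono fun t ht => (hpos t).ne' ht
  rw [← hrestrict]
  exact (Measure.restrict_eq_self_of_ae_mem (mem_ae_iff.2 hμS)).symm

end PointMasses

theorem hasSum_int_of_hasSum_add_neg {f : ℤ → ℝ} (hf : ∀ n, 0 ≤ f n) {S : ℝ}
    (h : HasSum (fun n : ℕ => f (n + 1) + f (-(n + 1))) S) : HasSum f (S + f 0) := by
  have hpos : Summable fun n : ℕ => f (n + 1) :=
    h.summable.of_nonneg_of_le (fun _ => hf _) fun _ => le_add_of_nonneg_right (hf _)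
  have hneg : Summable fun n : ℕ => f (-(n + 1)) :=
    h.summable.of_nonneg_of_le (fun _ => hf _) fun _ => le_add_of_nonneg_left (hf _)
  have hsum := hpos.hasSum.of_add_one_of_neg_add_one hneg.hasSum
  rwa [add_right_comm, (hpos.hasSum.add hneg.hasSum).unique h] at hsum

theorem hasSum_upperPoissonKernel_intCast {z : ℂ} (hz : 0 < z.im) :
    HasSum (fun n : ℤ => upperPoissonKernel z n) (-(Complex.cot (π * z)).im) := by
  have hcot : HasSum (cotTerm z) (π * Complex.cot (π * z) - 1 / z) := by
    have hz' : z ∈ Complex.integerComplement := UpperHalfPlane.coe_mem_integerComplement ⟨z, hz⟩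
    rw [cot_series_rep' hz']
    exact (summable_cotTerm hz').hasSum
  have hterm (n : ℕ) : upperPoissonKernel z (n + 1 : ℤ) + upperPoissonKernel z (-(n + 1) : ℤ) =
      -(cotTerm z n).im / π := by
    have hplus : (((n + 1 : ℤ) : ℝ) : ℂ) - z = -(z - (n + 1)) := by push_cast; ring
    have hminus : (((-(n + 1) : ℤ) : ℝ) : ℂ) - z = -(z + (n + 1)) := by push_cast; ring
    rw [upperPoissonKernel, upperPoissonKernel, hplus, hminus, inv_neg, inv_neg, Complex.neg_im,
      Complex.neg_im, cotTerm, one_div, one_div, Complex.add_im]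
    ring
  have hpairs := (((Complex.hasSum_im hcot).neg).div_const π).congr_fun hterm
  have hzero : upperPoissonKernel z (0 : ℤ) = -(1 / z).im / π := by
    rw [upperPoissonKernel, Int.cast_zero, Complex.ofReal_zero, zero_sub, inv_neg, Complex.neg_im,
      one_div]
  have hvalue : -(Complex.cot (π * z)).im =
      -(π * Complex.cot (π * z) - 1 / z).im / π + upperPoissonKernel z (0 : ℤ) := by
    rw [hzero, Complex.sub_im, Complex.im_ofReal_mul]
    field_simp
    ring
  rw [hvalue]
  exact hasSum_int_of_hasSum_add_neg (f := fun n : ℤ => upperPoissonKernel z n)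
    (fun n => (upperPoissonKernel_pos hz n).le) hpairs

/-! ### Dirac combs -/

/-- The measure with a point mass `m` at each point of the progression `x₀ + hℤ`. -/
def diracComb (m : ℝ≥0∞) (x₀ h : ℝ) : Measure ℝ :=
  Measure.sum fun n : ℤ => m • Measure.dirac (x₀ + n * h)

section DiracComb

variable {m : ℝ≥0∞} {x₀ h : ℝ}

theorem hasSum_upperPoissonKernel_add_mul (hh : 0 < h) {w : ℂ} (hw : 0 < w.im) :
    HasSum (fun n : ℤ => upperPoissonKernel w (x₀ + n * h))
      (-(h⁻¹ * (Complex.cot (π * ((w - x₀) / h))).im)) := by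
  have hz : 0 < ((w - x₀) / h).im := by
    rw [Complex.div_ofReal_im, Complex.sub_im, Complex.ofReal_im, sub_zero]
    positivity
  simp_rw [upperPoissonKernel_comp_affine hh.ne', ← mul_neg]
  exact (hasSum_upperPoissonKernel_intCast hz).mul_left h⁻¹

theorem integrable_diracComb (hm : m ≠ ∞) (hh : 0 < h) :
    Integrable (fun t : ℝ => 1 / (1 + t ^ 2)) (diracComb m x₀ h) := by
  have hI : 0 < I.im := by rw [Complex.I_im]; exact one_pos
  refine integrable_sum_dirac (fun _ => hm) (Summable.mul_left _ ?_)
  refine ((hasSum_upperPoissonKernel_add_mul (x₀ := x₀) hh hI).summable.mul_left π).congr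
    fun n => ?_
  rw [upperPoissonKernel_eq_div, Real.norm_of_nonneg (by positivity), Complex.I_re, Complex.I_im]
  field_simp
  ring

theorem integral_upperPoissonKernel_diracComb (hm : m ≠ ∞) (hh : 0 < h) {w : ℂ} (hw : 0 < w.im) :
    ∫ t, upperPoissonKernel w t ∂diracComb m x₀ h =
      -(m.toReal / h * (Complex.cot (π * ((w - x₀) / h))).im) := by
  rw [diracComb, integral_sum_dirac fun _ => hm]
  simp_rw [smul_eq_mul]
  rw [tsum_mul_left, (hasSum_upperPoissonKernel_add_mul hh hw).tsum_eq]
  ring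

theorem diracComb_compl_range : diracComb m x₀ h (range fun n : ℤ => x₀ + n * h)ᶜ = 0 := by
  have hmeas : MeasurableSet (range fun n : ℤ => x₀ + n * h)ᶜ :=
    (countable_range _).measurableSet.compl
  rw [diracComb, Measure.sum_apply _ hmeas, ENNReal.tsum_eq_zero]
  intro n
  rw [Measure.smul_apply, Measure.dirac_apply' _ hmeas,
    indicator_of_notMem (notMem_compl_iff.2 (mem_range_self n)), smul_zero]

theorem setOf_diracComb_singleton_ne_zero (hm : m ≠ 0) :
    {s : ℝ | diracComb m x₀ h {s} ≠ 0} = range fun n : ℤ => x₀ + n * h := by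
  refine Subset.antisymm (fun s hs => ?_) ?_
  · by_contra hmem
    exact hs (measure_mono_null (singleton_subset_iff.2 hmem) diracComb_compl_range)
  · rintro _ ⟨n, rfl⟩ hzero
    rw [diracComb, Measure.sum_apply _ (measurableSet_singleton _), ENNReal.tsum_eq_zero] at hzero
    refine hm ?_
    simpa only [Measure.smul_apply, Measure.dirac_apply_of_mem (mem_singleton _), smul_eq_mul,
      mul_one] using hzero n

theorem isClarkMeasure_iff_eq_diracComb {B : ℂ → ℂ} {α : ℂ} (hm : m ≠ ∞) (hh : 0 < h)
    (hB : ∀ w : ℂ, 0 < w.im → ((1 - B w * star α)⁻¹ * (1 + B w * star α)).re =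
      -(m.toReal / h * (Complex.cot (π * ((w - x₀) / h))).im)) (μ : Measure ℝ) :
    IsClarkMeasure B α μ ↔ μ = diracComb m x₀ h := by
  simp only [IsClarkMeasure, re_cauchyKernel_eq_upperPoissonKernel]
  constructor
  · rintro ⟨hμ, c, hc, hμB⟩
    refine eq_of_nevanlinna_eq_of_countable hμ (integrable_diracComb hm hh) hc
      (countable_range fun n : ℤ => x₀ + n * h) diracComb_compl_range fun w hw => ?_
    rw [← hμB w hw, hB w hw, integral_upperPoissonKernel_diracComb hm hh hw, zero_mul, zero_add]
  · rintro rfl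
    refine ⟨integrable_diracComb hm hh, 0, le_rfl, fun w hw => ?_⟩
    rw [hB w hw, integral_upperPoissonKernel_diracComb hm hh hw, zero_mul, zero_add]

end DiracComb

/-! ### The characteristic function of an interval -/

/-- The closed form of the characteristic function of `L₁`. It is unimodular on the real axis. -/
def intervalCharFun (a : ℝ) (w : ℂ) : ℂ := Complex.sin ((w - I) * a) / Complex.sin ((w + I) * a)

/-- The mass `2π / |B' s|` of the Clark measure at a real point `s`, where `B` is
`intervalCharFun a`. -/
def clarkMass (a s : ℝ) : ℝ := π * (Real.cosh (2 * a) - Real.cos (2 * (a * s))) /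
  (a * Real.sinh (2 * a))

theorem clarkMass_pos {a : ℝ} (ha : 0 < a) (s : ℝ) : 0 < clarkMass a s := by
  have hcosh : 1 < Real.cosh (2 * a) := Real.one_lt_cosh.2 (by positivity)
  have hcos : Real.cos (2 * (a * s)) ≤ 1 := Real.cos_le_one _
  have hsinh : 0 < Real.sinh (2 * a) := Real.sinh_pos_iff.2 (by positivity)
  exact div_pos (mul_pos Real.pi_pos (by linarith)) (mul_pos ha hsinh)

theorem sin_ne_zero_of_im_ne_zero {z : ℂ} (hz : z.im ≠ 0) : Complex.sin z ≠ 0 := by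
  rw [Complex.sin_ne_zero_iff]
  rintro k rfl
  exact hz (by rw [← Complex.ofReal_intCast, ← Complex.ofReal_mul, Complex.ofReal_im])

theorem sin_add_I_mul_ne_zero {a : ℝ} (ha : a ≠ 0) {w : ℂ} (hw : w.im ≠ -1) :
    Complex.sin ((w + I) * a) ≠ 0 := by
  refine sin_ne_zero_of_im_ne_zero ?_
  rw [Complex.im_mul_ofReal, Complex.add_im, Complex.I_im]
  exact mul_ne_zero (fun h => hw (eq_neg_of_add_eq_zero_left h)) ha

theorem star_intervalCharFun_ofReal (a s : ℝ) :
    star (intervalCharFun a s) = Complex.sin ((s + I) * a) / Complex.sin ((s - I) * a) := by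
  rw [intervalCharFun, star_div₀, ← starRingEnd_apply, ← starRingEnd_apply, ← Complex.sin_conj,
    ← Complex.sin_conj, map_mul, map_mul, map_sub, map_add, Complex.conj_I, Complex.conj_ofReal,
    Complex.conj_ofReal, sub_neg_eq_add, ← sub_eq_add_neg]

theorem cayley_div_mul_div {K : Type*} [Field K] {N D N₀ D₀ : K} (hD : D ≠ 0) (hN₀ : N₀ ≠ 0) :
    (1 - N / D * (D₀ / N₀))⁻¹ * (1 + N / D * (D₀ / N₀)) =
      (D * N₀ + N * D₀) / (D * N₀ - N * D₀) := by
  rw [div_mul_div_comm, one_sub_div (mul_ne_zero hD hN₀), one_add_div (mul_ne_zero hD hN₀),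
    inv_div, mul_comm, div_mul_div_cancel₀ (mul_ne_zero hD hN₀)]

theorem sin_add_mul_sin_sub_sub (x u κ : ℂ) :
    Complex.sin (u + κ) * Complex.sin (x - κ) - Complex.sin (u - κ) * Complex.sin (x + κ) =
      -(Complex.sin (2 * κ) * Complex.sin (u - x)) := by
  simp only [Complex.sin_add, Complex.sin_sub, Complex.sin_two_mul]
  ring

theorem sin_add_mul_sin_sub_add (x u κ : ℂ) :
    Complex.sin (u + κ) * Complex.sin (x - κ) + Complex.sin (u - κ) * Complex.sin (x + κ) =
      (Complex.cos (2 * κ) - Complex.cos (2 * x)) * Complex.cos (u - x) +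
        Complex.sin (2 * x) * Complex.sin (u - x) := by
  simp only [Complex.sin_add, Complex.sin_sub, Complex.cos_sub, Complex.sin_two_mul,
    Complex.cos_two_mul]
  linear_combination
    2 * Complex.cos u * Complex.cos x *
      (Complex.sin_sq_add_cos_sq x - Complex.sin_sq_add_cos_sq κ)

theorem cayley_intervalCharFun {a : ℝ} (ha : 0 < a) (s : ℝ) {w : ℂ} (hw : 0 < w.im) :
    (1 - intervalCharFun a w * star (intervalCharFun a s))⁻¹ *
      (1 + intervalCharFun a w * star (intervalCharFun a s)) =
      I * ((clarkMass a s / (π / a) : ℝ) * Complex.cot (a * w - a * s) +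
        (Real.sin (2 * (a * s)) / Real.sinh (2 * a) : ℝ)) := by
  have hD : Complex.sin ((w + I) * a) ≠ 0 := sin_add_I_mul_ne_zero ha.ne' (by linarith)
  have hN : Complex.sin ((s - I) * a) ≠ 0 := sin_ne_zero_of_im_ne_zero (by
    rw [Complex.im_mul_ofReal, Complex.sub_im, Complex.ofReal_im, Complex.I_im]
    linarith)
  have hS : Complex.sin (a * w - a * s) ≠ 0 := sin_ne_zero_of_im_ne_zero (by
    rw [Complex.sub_im, Complex.im_ofReal_mul, Complex.im_ofReal_mul, Complex.ofReal_im]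
    simpa using ⟨ha.ne', hw.ne'⟩)
  have hsinh : Complex.sinh (2 * a) ≠ 0 := by
    have h : Real.sinh (2 * a) ≠ 0 := (Real.sinh_pos_iff.2 (by positivity)).ne'
    exact_mod_cast h
  have hκ : 2 * (a * I) = 2 * a * I := by ring
  have ha' : (a : ℂ) ≠ 0 := Complex.ofReal_ne_zero.2 ha.ne'
  rw [star_intervalCharFun_ofReal, intervalCharFun, cayley_div_mul_div hD hN]
  simp only [add_mul, sub_mul, mul_comm w, mul_comm (s : ℂ), mul_comm I]
  rw [sin_add_mul_sin_sub_sub, sin_add_mul_sin_sub_add, hκ, Complex.cos_mul_I, Complex.sin_mul_I,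
    Complex.cot, clarkMass]
  generalize Complex.sin (a * w - a * s) = S at hS ⊢
  generalize Complex.cos (a * w - a * s) = C
  push_cast
  field_simp
  linear_combination ((Complex.cos (2 * a * s) - Complex.cosh (2 * a)) * C -
    Complex.sin (2 * a * s) * S) * Complex.I_sq

theorem re_cayley_intervalCharFun {a : ℝ} (ha : 0 < a) (s : ℝ) {w : ℂ} (hw : 0 < w.im) :
    ((1 - intervalCharFun a w * star (intervalCharFun a s))⁻¹ *
      (1 + intervalCharFun a w * star (intervalCharFun a s))).re =
      -(clarkMass a s / (π / a) * (Complex.cot (π * ((w - s) / ((π / a : ℝ) : ℂ)))).im) := by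
  have hπ : (π : ℂ) ≠ 0 := Complex.ofReal_ne_zero.2 Real.pi_ne_zero
  have harg : (π : ℂ) * ((w - s) / ((π / a : ℝ) : ℂ)) = a * w - a * s := by
    push_cast
    field_simp
  rw [cayley_intervalCharFun ha s hw, harg, Complex.I_mul_re, Complex.add_im,
    Complex.im_ofReal_mul, Complex.ofReal_im, add_zero]

theorem isClarkMeasure_intervalCharFun_iff {a : ℝ} (ha : 0 < a) (s : ℝ) (μ : Measure ℝ) :
    IsClarkMeasure (intervalCharFun a) (intervalCharFun a s) μ ↔
      μ = diracComb (ENNReal.ofReal (clarkMass a s)) s (π / a) := by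
  refine isClarkMeasure_iff_eq_diracComb ENNReal.ofReal_ne_top (by positivity) (fun w hw => ?_) μ
  rw [re_cayley_intervalCharFun ha s hw, ENNReal.toReal_ofReal (clarkMass_pos ha s).le]

theorem intervalCharFun_div {a : ℝ} (ha : a ≠ 0) (θ : ℝ) :
    intervalCharFun a (θ / a : ℝ) = Complex.sin (θ - I * a) / Complex.sin (θ + I * a) := by
  rw [intervalCharFun, sub_mul, add_mul, Complex.ofReal_div,
    div_mul_cancel₀ _ (Complex.ofReal_ne_zero.2 ha)]

theorem cos_I_mul_ne_zero (a : ℝ) : Complex.cos (I * a) ≠ 0 := by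
  rw [mul_comm, Complex.cos_mul_I, ← Complex.ofReal_cosh]
  exact Complex.ofReal_ne_zero.2 (Real.cosh_pos a).ne'

theorem intervalCharFun_pi_div_two_div {a : ℝ} (ha : a ≠ 0) :
    intervalCharFun a (π / 2 / a : ℝ) = 1 := by
  rw [intervalCharFun_div ha, Complex.ofReal_div, Complex.ofReal_ofNat, Complex.sin_pi_div_two_sub,
    add_comm, Complex.sin_add_pi_div_two, div_self (cos_I_mul_ne_zero a)]

theorem intervalCharFun_neg_pi_div_two_div {a : ℝ} (ha : a ≠ 0) :
    intervalCharFun a (-(π / 2) / a : ℝ) = 1 := by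
  rw [intervalCharFun_div ha, Complex.ofReal_neg, ← neg_add', neg_add_eq_sub, ← neg_sub,
    Complex.sin_neg, Complex.sin_neg, Complex.ofReal_div, Complex.ofReal_ofNat,
    Complex.sin_pi_div_two_sub, add_comm, Complex.sin_add_pi_div_two,
    div_self (neg_ne_zero.2 (cos_I_mul_ne_zero a))]

theorem sin_sub_div_sin_add {x y : ℂ} (hx : Complex.cos x ≠ 0) (hy : Complex.cos y ≠ 0) :
    Complex.sin (x - y) / Complex.sin (x + y) =
      (Complex.tan x - Complex.tan y) / (Complex.tan x + Complex.tan y) := by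
  have hsub : Complex.sin (x - y) =
      Complex.cos x * Complex.cos y * (Complex.tan x - Complex.tan y) := by
    rw [Complex.sin_sub, Complex.tan_eq_sin_div_cos, Complex.tan_eq_sin_div_cos]
    field_simp
  have hadd : Complex.sin (x + y) =
      Complex.cos x * Complex.cos y * (Complex.tan x + Complex.tan y) := by
    rw [Complex.sin_add, Complex.tan_eq_sin_div_cos, Complex.tan_eq_sin_div_cos]
    field_simp
  rw [hsub, hadd, mul_div_mul_left _ _ (mul_ne_zero hx hy)]

theorem intervalCharFun_arctan_div {a : ℝ} (ha : a ≠ 0) {α : ℂ} (hα : ‖α‖ = 1) (hα1 : α ≠ 1)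
    {r : ℝ} (hr : (r : ℂ) = (star α + 1) / (star α - 1) * Complex.tan (I * a)) :
    intervalCharFun a (Real.arctan r / a : ℝ) = α := by
  have hα0 : α ≠ 0 := norm_ne_zero_iff.1 (hα ▸ one_ne_zero)
  have hstar : star α = α⁻¹ := (Complex.inv_eq_conj hα).symm
  have htan : Complex.tan (I * a) ≠ 0 := by
    rw [mul_comm, Complex.tan_mul_I, ← Complex.ofReal_tanh]
    refine mul_ne_zero (Complex.ofReal_ne_zero.2 ?_) Complex.I_ne_zero
    rw [Real.tanh_eq_sinh_div_cosh]
    exact div_ne_zero (Real.sinh_ne_zero.2 ha) (Real.cosh_pos a).ne'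
  have hcos : Complex.cos (Real.arctan r : ℝ) ≠ 0 := by
    rw [← Complex.ofReal_cos]
    exact Complex.ofReal_ne_zero.2 (Real.cos_arctan_pos r).ne'
  have hden : 1 - α ≠ 0 := sub_ne_zero.2 hα1.symm
  rw [intervalCharFun_div ha, sin_sub_div_sin_add hcos (cos_I_mul_ne_zero a), ← Complex.ofReal_tan,
    Real.tan_arctan, hr, hstar, ← sub_one_mul, ← add_one_mul, mul_div_mul_right _ _ htan]
  field_simp
  ring

theorem exists_ofReal_eq_cayley_mul_tan (a : ℝ) {β : ℂ} (hβ : ‖β‖ = 1) :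
    ∃ r : ℝ, (r : ℂ) = (β + 1) / (β - 1) * Complex.tan (I * a) := by
  have hβ0 : β ≠ 0 := norm_ne_zero_iff.1 (hβ ▸ one_ne_zero)
  have hcayley : conj ((β + 1) / (β - 1)) = -((β + 1) / (β - 1)) := by
    rw [map_div₀, map_add, map_sub, map_one, ← Complex.inv_eq_conj hβ, ← div_neg, neg_sub,
      ← mul_div_mul_left _ _ hβ0, mul_add, mul_sub, mul_inv_cancel₀ hβ0, mul_one, add_comm]
  have htan : conj (Complex.tan (I * a)) = -Complex.tan (I * a) := by
    rw [← Complex.tan_conj, map_mul, Complex.conj_I, Complex.conj_ofReal, neg_mul, Complex.tan_neg]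
  obtain ⟨r, hr⟩ := Complex.conj_eq_iff_real.1
    (show conj ((β + 1) / (β - 1) * Complex.tan (I * a)) = _ by
      rw [map_mul, hcayley, htan, neg_mul_neg])
  exact ⟨r, hr.symm⟩

theorem exists_intervalCharFun_eq {a : ℝ} (ha : a ≠ 0) {α : ℂ} (hα : ‖α‖ = 1) :
    ∃ s : ℝ, intervalCharFun a s = α := by
  by_cases hα1 : α = 1
  · exact ⟨π / 2 / a, by rw [intervalCharFun_pi_div_two_div ha, hα1]⟩
  · obtain ⟨r, hr⟩ := exists_ofReal_eq_cayley_mul_tan a (β := star α) (by rw [norm_star, hα])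
    exact ⟨Real.arctan r / a, intervalCharFun_arctan_div ha hα hα1 hr⟩

theorem setOf_singleton_ne_zero_of_isClarkMeasure {a : ℝ} (ha : 0 < a) {θ : ℝ} {α : ℂ}
    (hθ : intervalCharFun a (θ / a : ℝ) = α) {μ : Measure ℝ}
    (hμ : IsClarkMeasure (intervalCharFun a) α μ) :
    {s : ℝ | μ {s} ≠ 0} = {s : ℝ | ∃ n : ℤ, s = 1 / a * θ + n * π / a} := by
  rw [← hθ, isClarkMeasure_intervalCharFun_iff ha] at hμ
  rw [hμ, setOf_diracComb_singleton_ne_zero (ENNReal.ofReal_pos.2 (clarkMass_pos ha _)).ne']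
  ext s
  refine exists_congr fun n => ?_
  rw [eq_comm, one_div_mul_eq_div, mul_div_assoc]

theorem setOf_singleton_ne_zero_of_isClarkMeasure_of_ne_one {a : ℝ} (ha : 0 < a) {α : ℂ}
    (hα : ‖α‖ = 1) (hα1 : α ≠ 1) {μ : Measure ℝ} (hμ : IsClarkMeasure (intervalCharFun a) α μ) :
    {s : ℝ | μ {s} ≠ 0} = {s : ℝ | ∃ n : ℤ, (s : ℂ) =
      1 / a * Complex.arctan ((star α + 1) / (star α - 1) * Complex.tan (I * a)) + n * π / a} := by
  obtain ⟨r, hr⟩ := exists_ofReal_eq_cayley_mul_tan a (β := star α) (by rw [norm_star, hα])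
  rw [setOf_singleton_ne_zero_of_isClarkMeasure ha
    (intervalCharFun_arctan_div ha.ne' hα hα1 hr) hμ, ← hr, ← Complex.ofReal_arctan]
  norm_cast

/-! ### The fundamental theorem of calculus for absolutely continuous functions -/

theorem absolutelyContinuousOnInterval_of_dist_le {X Y : Type*} [PseudoMetricSpace X]
    [PseudoMetricSpace Y] {f : ℝ → X} {g : ℝ → Y} {c d : ℝ}
    (hf : AbsolutelyContinuousOnInterval f c d)
    (hgf : ∀ x ∈ uIcc c d, ∀ y ∈ uIcc c d, dist (g x) (g y) ≤ dist (f x) (f y)) :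
    AbsolutelyContinuousOnInterval g c d := by
  refine squeeze_zero' (.of_forall fun _ => Finset.sum_nonneg fun _ _ => dist_nonneg) ?_ hf
  filter_upwards [mem_inf_of_right (mem_principal_self _)] with J hJ
  exact Finset.sum_le_sum fun i hi => hgf _ (hJ.1 i hi).1 _ (hJ.1 i hi).2

section FundamentalTheorem

variable {E : Type*} [NormedAddCommGroup E] [NormedSpace ℝ E]

theorem absolutelyContinuousOnInterval_intervalIntegral {q : ℝ → E} {c d : ℝ}
    (hq : IntervalIntegrable q volume c d) :
    AbsolutelyContinuousOnInterval (fun x => ∫ t in c..x, q t) c d := by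
  refine absolutelyContinuousOnInterval_of_dist_le
    (hq.norm.absolutelyContinuousOnInterval_intervalIntegral left_mem_uIcc) fun x hx y hy => ?_
  have hqx : IntervalIntegrable q volume c x := hq.mono_set (uIcc_subset_uIcc_left hx)
  have hqy : IntervalIntegrable q volume c y := hq.mono_set (uIcc_subset_uIcc_left hy)
  rw [dist_eq_norm, Real.dist_eq, intervalIntegral.integral_interval_sub_left hqx hqy,
    intervalIntegral.integral_interval_sub_left hqx.norm hqy.norm]
  exact intervalIntegral.norm_integral_le_abs_integral_norm

variable [CompleteSpace E]

theorem intervalIntegral_eq_sub_of_ae_hasDerivAt {F q : ℝ → E} {c d : ℝ}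
    (hF : AbsolutelyContinuousOnInterval F c d) (hq : IntervalIntegrable q volume c d)
    (hderiv : ∀ᵐ x, x ∈ uIcc c d → HasDerivAt F (q x) x) : ∫ x in c..d, q x = F d - F c := by
  obtain ⟨C, hC⟩ :=
    (hF.sub (absolutelyContinuousOnInterval_intervalIntegral hq)).const_of_ae_hasDerivAt_zero (by
      filter_upwards [hderiv, hq.ae_hasDerivAt_integral] with x hFx hqx hx
      simpa only [sub_self] using (hFx hx).sub (hqx hx c left_mem_uIcc))
  have hc := hC c left_mem_uIcc
  have hd := hC d right_mem_uIcc
  simp only [Pi.sub_apply, intervalIntegral.integral_same, sub_zero] at hc hd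
  rw [hc, ← hd, sub_sub_cancel]

theorem setIntegral_Ioo_eq_sub_of_tendsto {F q : ℝ → E} {b c : ℝ} {l r : E} (hbc : b < c)
    (hF : ∀ x ∈ Ioo b c, ∀ y ∈ Ioo b c, AbsolutelyContinuousOnInterval F x y)
    (hq : IntegrableOn q (Ioo b c))
    (hderiv : ∀ᵐ x ∂volume.restrict (Ioo b c), HasDerivAt F (q x) x)
    (hl : Tendsto F (𝓝[>] b) (𝓝 l)) (hr : Tendsto F (𝓝[<] c) (𝓝 r)) :
    ∫ x in Ioo b c, q x = r - l := by
  have hb : Tendsto Prod.fst (𝓝[>] b ×ˢ 𝓝[<] c) (𝓝[>] b) := tendsto_fst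
  have hc : Tendsto Prod.snd (𝓝[>] b ×ˢ 𝓝[<] c) (𝓝[<] c) := tendsto_snd
  have hcover := (aecover_Ioo_of_Ioc (μ := volume) (hb.mono_right nhdsWithin_le_nhds)
    (hc.mono_right nhdsWithin_le_nhds)).integral_tendsto_of_countably_generated hq
  refine tendsto_nhds_unique hcover (((hr.comp hc).sub (hl.comp hb)).congr' ?_)
  obtain ⟨m, hbm, hmc⟩ := exists_between hbc
  filter_upwards [hb.eventually (Ioo_mem_nhdsGT hbm), hc.eventually (Ioo_mem_nhdsLT hmc)]
    with p hp₁ hp₂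
  have h₁ : p.1 ∈ Ioo b c := ⟨hp₁.1, hp₁.2.trans hmc⟩
  have h₂ : p.2 ∈ Ioo b c := ⟨hbm.trans hp₂.1, hp₂.2⟩
  have hle : p.1 ≤ p.2 := (hp₁.2.trans hp₂.1).le
  have hsub : uIcc p.1 p.2 ⊆ Ioo b c := ordConnected_Ioo.uIcc_subset h₁ h₂
  rw [Measure.restrict_restrict_of_subset
    ((Ioc_subset_Icc_self.trans_eq (uIcc_of_le hle).symm).trans hsub),
    ← intervalIntegral.integral_of_le hle]
  exact (intervalIntegral_eq_sub_of_ae_hasDerivAt (hF _ h₁ _ h₂)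
    (hq.mono_set hsub).intervalIntegrable
    (((ae_restrict_iff' measurableSet_Ioo).1 hderiv).mono fun x hx hxp => hx (hsub hxp))).symm

end FundamentalTheorem

/-! ### Defect spaces and extensions of symmetric operators -/

section SymmetricOperator

variable {H : Type*} [NormedAddCommGroup H] [InnerProductSpace ℂ H] {ψ : ℂ → H}

theorem unitDefect_ne_zero {w : ℂ} (hw : ψ w ≠ 0) : unitDefect ψ w ≠ 0 :=
  smul_ne_zero (inv_ne_zero (Complex.ofReal_ne_zero.2 (norm_ne_zero_iff.2 hw))) hw

theorem livsic_eq_of_norm_eq (hψ : ψ I ≠ 0) (hnorm : ‖ψ (-I)‖ = ‖ψ I‖) (w : ℂ) :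
    livsic ψ w = ((w + I) * inner ℂ (ψ I) (ψ w))⁻¹ * ((w - I) * inner ℂ (ψ (-I)) (ψ w)) := by
  have hn : (‖ψ I‖ : ℂ) ≠ 0 := Complex.ofReal_ne_zero.2 (norm_ne_zero_iff.2 hψ)
  rw [livsic, gram, gram, unitDefect, unitDefect, inner_smul_left, inner_smul_left, hnorm, map_inv₀,
    Complex.conj_ofReal, mul_inv, mul_inv, inv_inv]
  field_simp

variable [CompleteSpace H] {T : H →ₗ.[ℂ] H}

theorem mem_graph_adjoint_of_mem_defectSpace {z : ℂ} {x : H} (hx : x ∈ defectSpace T z) :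
    (x, z • x) ∈ T.adjoint.graph :=
  Submodule.mem_comap.1 hx

theorem mem_defectSpace_iff (hT : Dense (T.domain : Set H)) {z : ℂ} {x : H} :
    x ∈ defectSpace T z ↔ ∀ u v, (u, v) ∈ T.graph → inner ℂ v x = z * inner ℂ u x := by
  rw [defectSpace, LinearPMap.adjoint_graph_eq_graph_adjoint hT, Submodule.mem_comap,
    Submodule.mem_adjoint_iff]
  change (∀ u v, (u, v) ∈ T.graph → inner ℂ v x - inner ℂ u (z • x) = 0) ↔ _
  simp only [inner_smul_right, sub_eq_zero]

theorem eq_zero_of_add_mem_domain (hT : Dense (T.domain : Set H)) (hsymm : T.IsFormalAdjoint T)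
    {z : ℂ} (hz : z.im ≠ 0) {x y : H} (hx : x ∈ defectSpace T z)
    (hy : y ∈ defectSpace T (conj z)) (hxy : x + y ∈ T.domain) : x = 0 := by
  have hgraph : (x + y, z • x + conj z • y) ∈ T.graph := by
    have hTxy := LinearPMap.mem_graph T ⟨x + y, hxy⟩
    rwa [LinearPMap.mem_graph_snd_inj T.adjoint
      (LinearPMap.le_graph_of_le (hsymm.le_adjoint hT) hTxy) (Submodule.add_mem _
        (mem_graph_adjoint_of_mem_defectSpace hx) (mem_graph_adjoint_of_mem_defectSpace hy)) rfl]
      at hTxy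
  have hinner := (mem_defectSpace_iff hT).1 hx _ _ hgraph
  rw [inner_add_left, inner_add_left, inner_smul_left, inner_smul_left, Complex.conj_conj, mul_add,
    add_left_inj] at hinner
  by_contra hx0
  exact hz (Complex.conj_eq_iff_im.1 (mul_right_cancel₀ (inner_self_ne_zero.2 hx0) hinner))

theorem unitDefect_mem_defectSpace (hψ : IsDefectBasis T ψ) {w : ℂ} (hw : w.im ≠ 0) :
    unitDefect ψ w ∈ defectSpace T w :=
  Submodule.smul_mem _ _ ((hψ.2 w hw).2 ▸ Submodule.mem_span_singleton_self _)

theorem mem_domain_extension (hψ : IsDefectBasis T ψ) (α : ℂ) :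
    α • unitDefect ψ (-I) - unitDefect ψ I ∈ (extension T ψ α).domain := by
  have hdom {w : ℂ} (hw : w.im ≠ 0) : unitDefect ψ w ∈ T.adjoint.domain :=
    LinearPMap.mem_domain_of_mem_graph
      (mem_graph_adjoint_of_mem_defectSpace (unitDefect_mem_defectSpace hψ hw))
  exact ⟨Submodule.mem_sup_right (Submodule.mem_span_singleton_self _),
    Submodule.sub_mem _ (Submodule.smul_mem _ _ (hdom (by simp))) (hdom (by simp))⟩

theorem extension_injective (hψ : IsDefectBasis T ψ) (hsymm : T.IsFormalAdjoint T) :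
    Function.Injective (extension T ψ) := by
  intro α β hαβ
  have hmem := mem_domain_extension hψ α
  rw [hαβ] at hmem
  obtain ⟨d, hd, v, hv, hdv⟩ := Submodule.mem_sup.1 hmem.1
  obtain ⟨k, rfl⟩ := Submodule.mem_span_singleton.1 hv
  have hI : (I : ℂ).im ≠ 0 := by simp
  have hnegI : (-I : ℂ).im ≠ 0 := by simp
  have hplus : (k - 1) • unitDefect ψ I ∈ defectSpace T I :=
    Submodule.smul_mem _ _ (unitDefect_mem_defectSpace hψ hI)
  have hminus : (α - k * β) • unitDefect ψ (-I) ∈ defectSpace T (-I) :=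
    Submodule.smul_mem _ _ (unitDefect_mem_defectSpace hψ hnegI)
  have hsum : (k - 1) • unitDefect ψ I + (α - k * β) • unitDefect ψ (-I) = d := by
    rw [eq_sub_of_add_eq hdv]
    module
  have hk : (k - 1) • unitDefect ψ I = 0 :=
    eq_zero_of_add_mem_domain hψ.1 hsymm hI hplus (by rwa [Complex.conj_I]) (hsum ▸ hd)
  have hα : (α - k * β) • unitDefect ψ (-I) = 0 := by
    rw [hk, zero_add] at hsum
    exact eq_zero_of_add_mem_domain hψ.1 hsymm hnegI hminus (Submodule.zero_mem _)
      (by rwa [add_zero, hsum])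
  rw [smul_eq_zero_iff_left (unitDefect_ne_zero (hψ.2 _ hI).1), sub_eq_zero] at hk
  rwa [smul_eq_zero_iff_left (unitDefect_ne_zero (hψ.2 _ hnegI).1), hk, one_mul, sub_eq_zero] at hα

theorem isClarkMeasureOf_extension_iff (hψ : IsDefectBasis T ψ) (hsymm : T.IsFormalAdjoint T)
    {α : ℂ} (hα : ‖α‖ = 1) {μ : Measure ℝ} :
    IsClarkMeasureOf T ψ (extension T ψ α) μ ↔ IsClarkMeasure (livsic ψ) α μ := by
  refine ⟨?_, fun h => ⟨hψ, α, hα, rfl, h⟩⟩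
  rintro ⟨-, β, -, hβ, h⟩
  rwa [extension_injective hψ hsymm hβ]

end SymmetricOperator

/-! ### The minimal operator and its defect spaces -/

section DuBoisReymond

open scoped ContDiff

variable {V E : Type*} [NormedAddCommGroup V] [NormedSpace ℝ V] [FiniteDimensional ℝ V]
  [MeasurableSpace V] [BorelSpace V] [NormedAddCommGroup E] [NormedSpace ℝ E] [CompleteSpace E]

theorem ae_eq_setAverage_of_integral_smul_eq_zero {μ : Measure V} {U : Set V} {G : V → E}
    (hU : IsOpen U) (hμU : μ U ≠ ⊤) (hG : IntegrableOn G U μ)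
    (horth : ∀ φ : V → ℝ, ContDiff ℝ ∞ φ → ∫ x in U, φ x ∂μ = 0 → ∫ x in U, φ x • G x ∂μ = 0) :
    G =ᵐ[μ.restrict U] fun _ => ⨍ x in U, G x ∂μ := by
  set M : E := ⨍ x in U, G x ∂μ
  have hzero : ∀ᵐ x ∂μ, x ∈ U → G x - M = 0 := by
    refine hU.ae_eq_zero_of_integral_contDiff_smul_eq_zero
      (hG.sub (integrableOn_const hμU)).locallyIntegrableOn fun g hg hgc hgU => ?_
    obtain ⟨C, hC⟩ := hg.continuous.bounded_above_of_compact_support hgc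
    have hgint : IntegrableOn g U μ :=
      Measure.integrableOn_of_bounded hμU hg.continuous.aestronglyMeasurable
        (.of_forall hC)
    have hgG : IntegrableOn (fun x => g x • G x) U μ :=
      hG.bdd_smul C hg.continuous.aestronglyMeasurable (.of_forall hC)
    have hmean := horth (fun x => g x - ⨍ y in U, g y ∂μ) (hg.sub contDiff_const)
      (setAverage_sub_setAverage hμU g)
    simp only [sub_smul] at hmean
    rw [integral_sub hgG (hG.fun_smul _), integral_smul, sub_eq_zero] at hmean
    rw [← setIntegral_eq_integral_of_forall_compl_eq_zero (s := U) fun x hx => by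
      rw [image_eq_zero_of_notMem_tsupport fun h => hx (hgU h), zero_smul]]
    simp only [smul_sub]
    rw [integral_sub hgG (hgint.smul_const M), integral_smul_const, hmean,
      ← measure_smul_setAverage G hμU, ← measure_smul_setAverage g hμU, smul_comm, smul_assoc,
      sub_self]
  filter_upwards [(ae_restrict_iff' hU.measurableSet).2 hzero] with x hx using sub_eq_zero.1 hx

end DuBoisReymond

theorem memLp_Ioo_of_continuousOn_Icc {E : Type*} [NormedAddCommGroup E] {b c : ℝ} {k : ℝ → E}
    {p : ℝ≥0∞} (hk : ContinuousOn k (Icc b c)) : MemLp k p (volume.restrict (Ioo b c)) := by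
  obtain ⟨C, hC⟩ := isCompact_Icc.exists_bound_of_continuousOn hk
  refine MemLp.of_bound ((hk.mono Ioo_subset_Icc_self).aestronglyMeasurable measurableSet_Ioo) C ?_
  filter_upwards [ae_restrict_mem measurableSet_Ioo] with x hx using hC x (Ioo_subset_Icc_self hx)

theorem coeFn_expVec (a : ℝ) (w : ℂ) :
    expVec a w =ᵐ[volume.restrict (Ioo (-a) a)] fun x : ℝ => Complex.exp (-I * w * x) :=
  MemLp.coeFn_toLp _

theorem hasDerivAt_exp_neg_I_mul (w : ℂ) (x : ℝ) :
    HasDerivAt (fun x : ℝ => Complex.exp (-I * w * x)) (-I * w * Complex.exp (-I * w * x)) x := by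
  have h := ((Complex.ofRealCLM.hasDerivAt (x := x)).const_mul (-I * w)).cexp
  simp only [Complex.ofRealCLM_apply, Complex.ofReal_one, mul_one] at h
  exact h.congr_deriv (mul_comm _ _)

theorem conj_exp_neg_I_mul (w : ℂ) (x : ℝ) :
    conj (Complex.exp (-I * w * x)) = Complex.exp (I * conj w * x) := by
  rw [← Complex.exp_conj, map_mul, map_mul, map_neg, Complex.conj_I, neg_neg, Complex.conj_ofReal]

theorem inner_eq_setIntegral {a : ℝ} {f g : L2 a} {F G : ℝ → ℂ}
    (hF : f =ᵐ[volume.restrict (Ioo (-a) a)] F) (hG : g =ᵐ[volume.restrict (Ioo (-a) a)] G) :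
    inner ℂ f g = ∫ x in Ioo (-a) a, conj (F x) * G x := by
  rw [L2.inner_def]
  refine integral_congr_ae ?_
  filter_upwards [hF, hG] with x hx hx'
  rw [RCLike.inner_apply, hx, hx', mul_comm]

theorem expVec_ne_zero {a : ℝ} (ha : 0 < a) (w : ℂ) : expVec a w ≠ 0 := by
  intro h
  have hae := coeFn_expVec a w
  rw [h] at hae
  have hEq : EqOn (fun x : ℝ => Complex.exp (-I * w * x)) (fun _ => 0) (Ioo (-a) a) :=
    Measure.eqOn_open_of_ae_eq (hae.symm.trans (Lp.coeFn_zero _ _ _)) isOpen_Ioo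
      (by fun_prop) continuousOn_const
  exact Complex.exp_ne_zero _ (hEq (show (0 : ℝ) ∈ Ioo (-a) a from ⟨neg_lt_zero.2 ha, ha⟩))

theorem ACLoc.continuousOn {a : ℝ} {F : ℝ → ℂ} (hF : ACLoc a F) : ContinuousOn F (Ioo (-a) a) := by
  intro x hx
  obtain ⟨c, hc, hcx⟩ := exists_between hx.1
  obtain ⟨d, hxd, hd⟩ := exists_between hx.2
  have h := (hF c ⟨hc, hcx.trans hx.2⟩ d ⟨hx.1.trans hxd, hd⟩).continuousOn
  rw [uIcc_of_le (hcx.trans hxd).le] at h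
  exact (h.continuousAt (Icc_mem_nhds hcx hxd)).continuousWithinAt

theorem mem_graph_minOp_iff_mem_maxGraph {a : ℝ} {p : L2 a × L2 a} :
    p ∈ (minOp a).graph ↔ p ∈ maxGraph a ∧ p.1 ∈ vanishing a := by
  have hg : (maxOp a).graph = maxGraph a :=
    Submodule.toLinearPMap_graph_eq _ (maxGraph_singleValued a)
  rw [← hg, LinearPMap.mem_graph_iff, LinearPMap.mem_graph_iff]
  constructor
  · rintro ⟨y, hy, hp⟩
    exact ⟨⟨⟨y, y.2.2⟩, hy, hp ▸ (LinearPMap.domRestrict_apply rfl).symm⟩, hy ▸ y.2.1⟩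
  · rintro ⟨⟨y, hy, hp⟩, hv⟩
    exact ⟨⟨y, ⟨hy ▸ hv, y.2⟩⟩, hy, hp ▸ LinearPMap.domRestrict_apply rfl⟩

theorem mem_graph_minOp {a : ℝ} (ha : 0 < a) {u v : L2 a} :
    (u, v) ∈ (minOp a).graph ↔ ∃ F : ℝ → ℂ, ACLoc a F ∧ u =ᵐ[volume.restrict (Ioo (-a) a)] F ∧
      (∀ᵐ x ∂volume.restrict (Ioo (-a) a), HasDerivAt F (-I * v x) x) ∧
      Tendsto F (𝓝[>] (-a)) (𝓝 0) ∧ Tendsto F (𝓝[<] a) (𝓝 0) := by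
  rw [mem_graph_minOp_iff_mem_maxGraph]
  constructor
  · rintro ⟨⟨F, hF, huF, hFv⟩, G, hG, huG, hleft, hright⟩
    have hEq : EqOn G F (Ioo (-a) a) :=
      Measure.eqOn_open_of_ae_eq (huG.symm.trans huF) isOpen_Ioo hG hF.continuousOn
    have hlt : -a < a := neg_lt_self ha
    exact ⟨F, hF, huF, hFv, hleft.congr' (hEq.eventuallyEq_of_mem (Ioo_mem_nhdsGT hlt)),
      hright.congr' (hEq.eventuallyEq_of_mem (Ioo_mem_nhdsLT hlt))⟩
  · rintro ⟨F, hF, huF, hFv, hleft, hright⟩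
    exact ⟨⟨F, hF, huF, hFv⟩, F, hF.continuousOn, huF, hleft, hright⟩

theorem mem_graph_minOp_of_contDiff {a : ℝ} (ha : 0 < a) {k : ℝ → ℂ} {u v : L2 a}
    (hk : ContDiff ℝ 1 k) (hleft : k (-a) = 0) (hright : k a = 0)
    (hu : u =ᵐ[volume.restrict (Ioo (-a) a)] k)
    (hv : v =ᵐ[volume.restrict (Ioo (-a) a)] fun x => I * deriv k x) :
    (u, v) ∈ (minOp a).graph := by
  refine (mem_graph_minOp ha).2 ⟨k, fun c _ d _ => hk.contDiffOn.absolutelyContinuousOnInterval, hu,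
    ?_, ?_, ?_⟩
  · filter_upwards [hv] with x hx
    rw [hx, ← mul_assoc, neg_mul, Complex.I_mul_I, neg_neg, one_mul]
    exact (hk.differentiable one_ne_zero x).hasDerivAt
  · exact hleft ▸ (hk.continuous.tendsto (-a)).mono_left nhdsWithin_le_nhds
  · exact hright ▸ (hk.continuous.tendsto a).mono_left nhdsWithin_le_nhds

theorem dense_domain_minOp {a : ℝ} (ha : 0 < a) : Dense ((minOp a).domain : Set (L2 a)) := by
  rw [Submodule.dense_iff_topologicalClosure_eq_top, Submodule.topologicalClosure_eq_top_iff,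
    Submodule.eq_bot_iff]
  intro f hf
  have hfint : IntegrableOn f (Ioo (-a) a) := (Lp.memLp f).integrable one_le_two
  rw [Lp.eq_zero_iff_ae_eq_zero]
  refine (ae_restrict_iff' measurableSet_Ioo).2
    (isOpen_Ioo.ae_eq_zero_of_integral_contDiff_smul_eq_zero hfint.locallyIntegrableOn
      fun g hg _ hgU => ?_)
  have hgzero : ∀ x, x ∉ Ioo (-a) a → g x = 0 := fun x hx =>
    image_eq_zero_of_notMem_tsupport fun h => hx (hgU h)
  have hk : ContDiff ℝ 1 fun x => (g x : ℂ) :=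
    Complex.ofRealCLM.contDiff.comp (hg.of_le (by simp))
  have hu := memLp_Ioo_of_continuousOn_Icc (p := 2) (hk.continuous.continuousOn (s := Icc (-a) a))
  have hv := memLp_Ioo_of_continuousOn_Icc (p := 2)
    ((hk.continuous_deriv le_rfl).const_mul I |>.continuousOn (s := Icc (-a) a))
  have hmem := LinearPMap.mem_domain_of_mem_graph (mem_graph_minOp_of_contDiff ha hk
    (by rw [hgzero _ (by simp), Complex.ofReal_zero])
    (by rw [hgzero _ (by simp), Complex.ofReal_zero]) hu.coeFn_toLp hv.coeFn_toLp)
  have horth := (Submodule.mem_orthogonal _ _).1 hf _ hmem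
  rw [inner_eq_setIntegral hu.coeFn_toLp (ae_eq_refl _)] at horth
  rw [← setIntegral_eq_integral_of_forall_compl_eq_zero (s := Ioo (-a) a) fun x hx => by
    rw [hgzero x hx, zero_smul], ← horth]
  simp only [Complex.conj_ofReal, Complex.real_smul]

theorem inner_eq_inner_of_mem_graph_minOp {a : ℝ} (ha : 0 < a) {u v f g : L2 a}
    {G : ℝ → ℂ} {l r : ℂ}
    (huv : (u, v) ∈ (minOp a).graph) (hG : ACLoc a G)
    (hfG : f =ᵐ[volume.restrict (Ioo (-a) a)] G)
    (hGg : ∀ᵐ x ∂volume.restrict (Ioo (-a) a), HasDerivAt G (-I * g x) x)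
    (hl : Tendsto G (𝓝[>] (-a)) (𝓝 l)) (hr : Tendsto G (𝓝[<] a) (𝓝 r)) :
    inner ℂ v f = inner ℂ u g := by
  obtain ⟨F, hF, huF, hFv, hFl, hFr⟩ := (mem_graph_minOp ha).1 huv
  have hprod {L : Filter ℝ} {c : ℂ} (hFL : Tendsto F L (𝓝 0)) (hGL : Tendsto G L (𝓝 c)) :
      Tendsto (fun x => star (F x) • G x) L (𝓝 0) := by
    simpa only [star_zero, zero_smul] using hFL.star.smul hGL
  have hint (p q : L2 a) : IntegrableOn (fun x => conj (p x) * q x) (Ioo (-a) a) :=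
    (Lp.memLp p).star.integrable_mul (Lp.memLp q)
  have hzero : ∫ x in Ioo (-a) a, I * (conj (v x) * f x - conj (u x) * g x) = 0 := by
    have hAC : ACLoc a fun x => star (F x) • G x := fun c hc d hd =>
      (absolutelyContinuousOnInterval_of_dist_le (hF c hc d hd) fun _ _ _ _ =>
        (dist_star_star _ _).le).smul (hG c hc d hd)
    refine (setIntegral_Ioo_eq_sub_of_tendsto (neg_lt_self ha) hAC
      (((hint v f).fun_sub (hint u g)).const_mul I) ?_ (hprod hFl hl) (hprod hFr hr)).trans
      (sub_zero 0)
    filter_upwards [hFv, hGg, huF, hfG] with x hFx hGx hux hfx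
    refine (hFx.star.mul hGx).congr_deriv ?_
    rw [hux, hfx, ← starRingEnd_apply, ← starRingEnd_apply, map_mul, map_neg, Complex.conj_I]
    ring
  rw [integral_const_mul, integral_sub (hint v f) (hint u g),
    ← inner_eq_setIntegral (ae_eq_refl _) (ae_eq_refl _),
    ← inner_eq_setIntegral (ae_eq_refl _) (ae_eq_refl _)] at hzero
  exact sub_eq_zero.1 ((mul_eq_zero.1 hzero).resolve_left Complex.I_ne_zero)

theorem isFormalAdjoint_minOp {a : ℝ} (ha : 0 < a) : (minOp a).IsFormalAdjoint (minOp a) := by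
  intro u f
  obtain ⟨G, hG, hfG, hGg, hl, hr⟩ := (mem_graph_minOp ha).1 (LinearPMap.mem_graph _ f)
  exact inner_eq_inner_of_mem_graph_minOp ha (LinearPMap.mem_graph _ u) hG hfG hGg hl hr

theorem exists_mem_graph_minOp_of_integral_eq_zero {a : ℝ} (ha : 0 < a) (z : ℂ) {φ : ℝ → ℝ}
    (hφ : Continuous φ) (hφ0 : ∫ x in Ioo (-a) a, φ x = 0) {h : L2 a}
    (hh : h =ᵐ[volume.restrict (Ioo (-a) a)] fun x => Complex.exp (-I * z * x) * φ x) :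
    ∃ u : L2 a, (u, z • u + I • h) ∈ (minOp a).graph := by
  set Φ : ℝ → ℝ := fun x => ∫ t in (-a)..x, φ t with hΦ
  set e : ℝ → ℂ := fun x => Complex.exp (-I * z * x)
  have hderiv (x : ℝ) : HasDerivAt (fun x => e x * Φ x) (-I * z * e x * Φ x + e x * φ x) x :=
    (hasDerivAt_exp_neg_I_mul z x).mul (hφ.integral_hasStrictDerivAt (-a) x).hasDerivAt.ofReal_comp
  have hcont : Continuous Φ := continuous_iff_continuousAt.2 fun x =>
    (hφ.integral_hasStrictDerivAt (-a) x).hasDerivAt.continuousAt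
  have hk : ContDiff ℝ 1 fun x => e x * Φ x := by
    refine contDiff_one_iff_deriv.2 ⟨fun x => (hderiv x).differentiableAt, ?_⟩
    rw [funext fun x => (hderiv x).deriv]
    fun_prop
  have hu := memLp_Ioo_of_continuousOn_Icc (p := 2) (hk.continuous.continuousOn (s := Icc (-a) a))
  refine ⟨hu.toLp _, mem_graph_minOp_of_contDiff ha hk ?_ ?_ hu.coeFn_toLp ?_⟩
  · simp only [hΦ, intervalIntegral.integral_same, Complex.ofReal_zero, mul_zero]
  · simp only [hΦ, intervalIntegral.integral_of_le (neg_le_self ha.le),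
      integral_Ioc_eq_integral_Ioo, hφ0, Complex.ofReal_zero, mul_zero]
  · filter_upwards [Lp.coeFn_add (z • hu.toLp _) (I • h), Lp.coeFn_smul z (hu.toLp _),
      Lp.coeFn_smul I h, hu.coeFn_toLp, hh] with x hadd hzu hIh hux hhx
    rw [hadd, Pi.add_apply, hzu, hIh, Pi.smul_apply, Pi.smul_apply, hux, hhx, (hderiv x).deriv,
      smul_eq_mul, smul_eq_mul]
    linear_combination (z * e x * Φ x) * Complex.I_sq

theorem expVec_mem_defectSpace {a : ℝ} (ha : 0 < a) (w : ℂ) :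
    expVec a w ∈ defectSpace (minOp a) w := by
  have hexp : ContDiff ℝ 1 fun x : ℝ => Complex.exp (-I * w * x) :=
    (contDiff_const.mul Complex.ofRealCLM.contDiff).cexp
  refine (mem_defectSpace_iff (dense_domain_minOp ha)).2 fun u v huv => ?_
  rw [← inner_smul_right]
  refine inner_eq_inner_of_mem_graph_minOp ha huv (fun c _ d _ =>
    hexp.contDiffOn.absolutelyContinuousOnInterval) (coeFn_expVec a w) ?_
    hexp.continuous.continuousWithinAt hexp.continuous.continuousWithinAt
  filter_upwards [Lp.coeFn_smul w (expVec a w), coeFn_expVec a w] with x hsmul hx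
  rw [hsmul, Pi.smul_apply, hx, smul_eq_mul, ← mul_assoc]
  exact hasDerivAt_exp_neg_I_mul w x

theorem defectSpace_minOp_le_span {a : ℝ} (ha : 0 < a) (w : ℂ) :
    defectSpace (minOp a) w ≤ Submodule.span ℂ {expVec a w} := by
  intro f hf
  have hgraph := (mem_defectSpace_iff (dense_domain_minOp ha)).1 hf
  have hexp : Continuous fun x : ℝ => Complex.exp (I * w * x) := by fun_prop
  have hint : IntegrableOn (fun x : ℝ => Complex.exp (I * w * x) * f x) (Ioo (-a) a) :=
    (memLp_Ioo_of_continuousOn_Icc (p := 2) hexp.continuousOn).integrable_mul (Lp.memLp f)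
  have horth : ∀ φ : ℝ → ℝ, ContDiff ℝ (⊤ : ℕ∞) φ → ∫ x in Ioo (-a) a, φ x = 0 →
      ∫ x in Ioo (-a) a, φ x • (Complex.exp (I * w * x) * f x) = 0 := by
    intro φ hφ hφ0
    have hφc := hφ.continuous
    have hmem : MemLp (fun x : ℝ => Complex.exp (-I * conj w * x) * φ x) 2
        (volume.restrict (Ioo (-a) a)) := memLp_Ioo_of_continuousOn_Icc (by fun_prop)
    obtain ⟨u, hu⟩ :=
      exists_mem_graph_minOp_of_integral_eq_zero ha (conj w) hφc hφ0 hmem.coeFn_toLp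
    have hinner : inner ℂ (hmem.toLp _) f = 0 := by
      have h := hgraph _ _ hu
      rw [inner_add_left, inner_smul_left, inner_smul_left, Complex.conj_conj, add_eq_left,
        Complex.conj_I] at h
      exact (mul_eq_zero.1 h).resolve_left (neg_ne_zero.2 Complex.I_ne_zero)
    rw [← hinner, inner_eq_setIntegral hmem.coeFn_toLp (ae_eq_refl _)]
    refine setIntegral_congr_fun measurableSet_Ioo fun x _ => ?_
    simp only [map_mul, conj_exp_neg_I_mul, Complex.conj_conj, Complex.conj_ofReal,
      Complex.real_smul]
    ring
  have hconst := ae_eq_setAverage_of_integral_smul_eq_zero isOpen_Ioo (by simp) hint horth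
  refine Submodule.mem_span_singleton.2
    ⟨⨍ x in Ioo (-a) a, Complex.exp (I * w * x) * f x, Lp.ext ?_⟩
  filter_upwards [hconst, Lp.coeFn_smul (⨍ x in Ioo (-a) a, Complex.exp (I * w * x) * f x)
    (expVec a w), coeFn_expVec a w] with x hconstx hsmul hx
  rw [hsmul, Pi.smul_apply, hx, ← hconstx, smul_eq_mul, mul_right_comm, ← Complex.exp_add,
    neg_mul, neg_mul, add_neg_cancel, Complex.exp_zero, one_mul]

theorem isDefectBasis_minOp {a : ℝ} (ha : 0 < a) : IsDefectBasis (minOp a) (expVec a) :=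
  ⟨dense_domain_minOp ha, fun w _ => ⟨expVec_ne_zero ha w,
    le_antisymm (defectSpace_minOp_le_span ha w)
      ((Submodule.span_singleton_le_iff_mem _ _).2 (expVec_mem_defectSpace ha w))⟩⟩

theorem mul_inner_expVec {a : ℝ} (ha : 0 < a) (z w : ℂ) :
    (w - conj z) * inner ℂ (expVec a z) (expVec a w) = 2 * Complex.sin ((w - conj z) * a) := by
  obtain hzw | hzw := eq_or_ne (w - conj z) 0
  · rw [hzw, zero_mul, zero_mul, Complex.sin_zero, mul_zero]
  have hexp (x : ℝ) : conj (Complex.exp (-I * z * x)) * Complex.exp (-I * w * x) =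
      Complex.exp (-I * (w - conj z) * x) := by
    rw [conj_exp_neg_I_mul, ← Complex.exp_add]
    ring_nf
  rw [inner_eq_setIntegral (coeFn_expVec a z) (coeFn_expVec a w)]
  simp only [hexp]
  rw [← integral_Ioc_eq_integral_Ioo, ← intervalIntegral.integral_of_le (neg_le_self ha.le),
    integral_exp_mul_complex (mul_ne_zero (neg_ne_zero.2 Complex.I_ne_zero) hzw), Complex.sin,
    Complex.ofReal_neg]
  field_simp
  ring_nf
  rw [Complex.I_sq]
  ring

theorem norm_expVec_neg_I {a : ℝ} (ha : 0 < a) : ‖expVec a (-I)‖ = ‖expVec a I‖ := by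
  have hplus := mul_inner_expVec ha I I
  have hminus := mul_inner_expVec ha (-I) (-I)
  rw [Complex.conj_I, sub_neg_eq_add, inner_self_eq_norm_sq_to_K] at hplus
  rw [map_neg, Complex.conj_I, neg_neg, ← neg_add', neg_mul, neg_mul, Complex.sin_neg, mul_neg,
    neg_inj, ← hplus, inner_self_eq_norm_sq_to_K] at hminus
  have hsq := mul_left_cancel₀ (by simp [← two_mul]) hminus
  exact (sq_eq_sq₀ (norm_nonneg _) (norm_nonneg _)).1 (mod_cast hsq)

theorem livsic_expVec {a : ℝ} (ha : 0 < a) : livsic (expVec a) = intervalCharFun a := by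
  funext w
  have hplus := mul_inner_expVec ha I w
  have hminus := mul_inner_expVec ha (-I) w
  rw [Complex.conj_I, sub_neg_eq_add] at hplus
  rw [map_neg, Complex.conj_I, neg_neg] at hminus
  rw [livsic_eq_of_norm_eq (expVec_ne_zero ha I) (norm_expVec_neg_I ha), hplus, hminus,
    intervalCharFun, inv_mul_eq_div, mul_div_mul_left _ _ two_ne_zero]

end ClarkInterval

end

theorem mainTheorem8 (a : ℝ) (ha : 0 < a) :
    -- the functions `e^{-iwx}` are a basis of the defect spaces of `L₁`
    ClarkInterval.IsDefectBasis (ClarkInterval.minOp a) (ClarkInterval.expVec a) ∧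
    -- the characteristic function of `L₁`
    (∀ w : ℂ, 0 < w.im →
      Complex.sin ((w + Complex.I) * a) ≠ 0 ∧
      ClarkInterval.livsic (ClarkInterval.expVec a) w =
        Complex.sin ((w - Complex.I) * a) / Complex.sin ((w + Complex.I) * a)) ∧
    -- the extension `L_{1,α}` has exactly one Clark measure, and its point masses are as stated
    ∀ α : ℂ, ‖α‖ = 1 →
      (∃! μ : MeasureTheory.Measure ℝ,
        ClarkInterval.IsClarkMeasureOf (ClarkInterval.minOp a) (ClarkInterval.expVec a)
          (ClarkInterval.extension (ClarkInterval.minOp a) (ClarkInterval.expVec a) α) μ) ∧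
      ∀ μ : MeasureTheory.Measure ℝ,
        ClarkInterval.IsClarkMeasureOf (ClarkInterval.minOp a) (ClarkInterval.expVec a)
          (ClarkInterval.extension (ClarkInterval.minOp a) (ClarkInterval.expVec a) α) μ →
        (α ≠ 1 →
          {s : ℝ | μ {s} ≠ 0} =
            {s : ℝ | ∃ n : ℤ, (s : ℂ) =
              1 / a * Complex.arctan ((star α + 1) / (star α - 1) * Complex.tan (Complex.I * a))
                + n * Real.pi / a}) ∧
        (α = 1 → ∀ θ : ℝ, (θ = Real.pi / 2 ∨ θ = -(Real.pi / 2)) →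
          {s : ℝ | μ {s} ≠ 0} = {s : ℝ | ∃ n : ℤ, s = 1 / a * θ + n * Real.pi / a}) := by
  have hbasis := ClarkInterval.isDefectBasis_minOp ha
  have hlivsic := ClarkInterval.livsic_expVec ha
  refine ⟨hbasis, fun w hw => ⟨ClarkInterval.sin_add_I_mul_ne_zero ha.ne' (by linarith),
    congrFun hlivsic w⟩, fun α hα => ?_⟩
  obtain ⟨s, rfl⟩ := ClarkInterval.exists_intervalCharFun_eq ha.ne' hα
  simp only [ClarkInterval.isClarkMeasureOf_extension_iff hbasis
    (ClarkInterval.isFormalAdjoint_minOp ha) hα, hlivsic]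
  refine ⟨⟨_, (ClarkInterval.isClarkMeasure_intervalCharFun_iff ha _ _).2 rfl, fun μ hμ =>
    (ClarkInterval.isClarkMeasure_intervalCharFun_iff ha _ _).1 hμ⟩, fun μ hμ => ⟨fun hα1 => ?_,
    fun hα1 θ hθ => ?_⟩⟩
  · exact ClarkInterval.setOf_singleton_ne_zero_of_isClarkMeasure_of_ne_one ha hα hα1 hμ
  · rw [hα1] at hμ
    refine ClarkInterval.setOf_singleton_ne_zero_of_isClarkMeasure ha ?_ hμ
    obtain rfl | rfl := hθ
    · exact ClarkInterval.intervalCharFun_pi_div_two_div ha.ne'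
    · exact ClarkInterval.intervalCharFun_neg_pi_div_two_div ha.ne'
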